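/- Let $n,s,p,w$ be natural numbers with $s\ge 1$. Let $Q_1,\dots,Q_s\in\mathbb{R}^{n\times n}$ be symmetric positive semidefinite matrices with $\sum_{i=1}^s Q_i\succ 0$, and let $$\mathscr{D}=\{\zeta\in\mathbb{R}^n : \langle Q_i\zeta,\zeta\rangle\le 1,\ i=1,\dots,s\}.$$ Let $\beta\in\mathbb{R}^w$, let $\mathcal{M}:\mathbb{R}^p\to\mathbb{R}^{w\times(n+1)}$ be affine, and let $\mathcal{V}$ map $\mathbb{R}^p$ to the symmetric $(n+1)\times(n+1)$ real matrices and be matrix convex, i.e. $\mathcal{V}[\mu\chi+(1-\mu)\hat\chi]\preceq\mu\mathcal{V}[\chi]+(1-\mu)\mathcal{V}[\hat\chi]$ for all $\mu\in[0,1]$ and $\chi,\hat\chi\in\mathbb{R}^p$, where $A\succeq B$ means that $A-B$ is symmetric positive semidefinite. For $\zeta\in\mathbb{R}^n$ put $\zeta_e=(1,\zeta^{\mathrm T})^{\mathrm T}\in\mathbb{R}^{n+1}$, and let $\Pi_h^{\mathrm T}=[\,0_{n\times 1}\ \ I_n\,]$, $\Pi_c^{\mathrm T}=[\,1\ \ 0_{1\times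 n}\,]$. For a symmetric $(n+1)\times(n+1)$ matrix $X$ and $\chi\in\mathbb{R}^p$ let $$\delta[X]=\Pi_h^{\mathrm T}X\Pi_h,\qquad \phi[X,\chi]^{\mathrm T}=\Pi_c^{\mathrm T}X\Pi_h+\beta^{\mathrm T}\mathcal{M}[\chi]\Pi_h,\qquad \psi[X,\chi]=\Pi_c^{\mathrm T}X\Pi_c+2\beta^{\mathrm T}\mathcal{M}[\chi]\Pi_c,$$ let $\Psi[\chi]=\psi[\mathcal{V}[\chi],\chi]$, and for $\xi=(\gamma,\lambda,X,\chi)$ with $\gamma\in\mathbb{R}$, $\lambda\in\mathbb{R}^s$ let $$F[\xi]=\begin{pmatrix}\gamma-\psi[X,\chi]-\sum_{i=1}^s\lambda_i & -\phi[X,\chi]^{\mathrm T}\\ -\phi[X,\chi] & \sum_{i=1}^s\lambda_iQ_i-\delta[X]\end{pmatrix}.$$ Consider the feasibility conditions $$F[\xi]\succeq 0,\qquad \lambda\ge 0,\qquad X\succeq\mathcal{V}[\chi].\tag{1}$$ (a) If $(\gamma,\chi)$ can be extended by some $\lambda\in\mathbb{R}^s$ and some symmetric $X$ to a point $\xi=(\gamma,\lambda,X,\chi)$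 satisfying (1), then $$\gamma\ \ge\ \zeta_e^{\mathrm T}\mathcal{V}[\chi]\zeta_e+2\langle\beta,\mathcal{M}[\chi]\zeta_e\rangle\qquad\text{for all }\zeta\in\mathscr{D}.$$ (b) The set of all $\xi=(\gamma,\lambda,X,\chi)$, with $X$ symmetric, that satisfy (1) is convex. (c) If $(\gamma,\chi)$ cannot be extended by any $\lambda$ and symmetric $X$ so that (1) holds, then for every $\epsilon>0$ there is a $\zeta\in\mathscr{D}$ with $$\zeta_e^{\mathrm T}\mathcal{V}[\chi]\zeta_e+2\langle\beta,\mathcal{M}[\chi]\zeta_e\rangle\ >\ \gamma^-,\qquad \gamma^-=\begin{cases}\gamma, & s=1,\\[2pt] \frac1\Theta\big(\gamma-\Psi[\chi]\big)+\Psi[\chi]-\epsilon, & s>1,\end{cases}$$ where $\Theta=2\ln(s+1)+2\sqrt{\ln(s+1)}+1$. -/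

import Mathlib

open scoped Matrix

namespace RobustQuad

/-- Index set of `ℝ^{1+n}`: the first coordinate is `Sum.inl ()`, the last `n` are `Sum.inr i`. -/
abbrev Idx (n : ℕ) : Type := Unit ⊕ Fin n

/-- The Loewner order `A ⪰ B`: the matrix `A - B` is symmetric positive semidefinite. -/
def LoewnerGE {ι : Type*} [Fintype ι] (A B : Matrix ι ι ℝ) : Prop :=
  (A - B).PosSemidef

/-- Matrix convexity with respect to the Loewner order. -/
def MatrixConvex {p : ℕ} {ι : Type*} [Fintype ι]
    (V : (Fin p → ℝ) → Matrix ι ι ℝ) : Prop :=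
  ∀ μ : ℝ, 0 ≤ μ → μ ≤ 1 → ∀ χ χ' : Fin p → ℝ,
    LoewnerGE (μ • V χ + (1 - μ) • V χ') (V (μ • χ + (1 - μ) • χ'))

/-- The intersection of ellipsoids `{ζ | ⟨Q i ζ, ζ⟩ ≤ 1 for all i}`. -/
def uncertaintySet {n s : ℕ} (Q : Fin s → Matrix (Fin n) (Fin n) ℝ) : Set (Fin n → ℝ) :=
  {ζ | ∀ i, (Q i *ᵥ ζ) ⬝ᵥ ζ ≤ 1}

/-- The extended vector `ζ_e = (1, ζ)`. -/
def extVec {n : ℕ} (ζ : Fin n → ℝ) : Idx n → ℝ := Sum.elim (fun _ => 1) ζ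

/-- `ζ_eᵀ V ζ_e + 2 ⟨β, M ζ_e⟩`. -/
def quadForm {n w : ℕ} (β : Fin w → ℝ) (M : Matrix (Fin w) (Idx n) ℝ)
    (V : Matrix (Idx n) (Idx n) ℝ) (ζ : Fin n → ℝ) : ℝ :=
  extVec ζ ⬝ᵥ (V *ᵥ extVec ζ) + 2 * (β ⬝ᵥ (M *ᵥ extVec ζ))

/-- `Π_h`, with `Π_hᵀ = [0 I]`. -/
def Pih (n : ℕ) : Matrix (Idx n) (Fin n) ℝ := Matrix.fromRows 0 1

/-- `Π_c`, with `Π_cᵀ = [1 0]`. -/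
def Pic (n : ℕ) : Matrix (Idx n) Unit ℝ := Matrix.fromRows 1 0

/-- `δ[X] = Π_hᵀ X Π_h`. -/
def delta {n : ℕ} (X : Matrix (Idx n) (Idx n) ℝ) : Matrix (Fin n) (Fin n) ℝ :=
  (Pih n)ᵀ * X * Pih n

/-- The row vector `φᵀ = Π_cᵀ X Π_h + βᵀ M Π_h`. -/
def phiT {n w : ℕ} (β : Fin w → ℝ) (X : Matrix (Idx n) (Idx n) ℝ)
    (M : Matrix (Fin w) (Idx n) ℝ) : Matrix Unit (Fin n) ℝ :=
  (Pic n)ᵀ * X * Pih n + Matrix.replicateRow Unit β * M * Pih n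

/-- The scalar `ψ = Π_cᵀ X Π_c + 2 βᵀ M Π_c` (the entry of a `1 × 1` matrix). -/
def psi {n w : ℕ} (β : Fin w → ℝ) (X : Matrix (Idx n) (Idx n) ℝ)
    (M : Matrix (Fin w) (Idx n) ℝ) : ℝ :=
  ((Pic n)ᵀ * X * Pic n + (2 : ℝ) • (Matrix.replicateRow Unit β * M * Pic n)) () ()

/-- The decision vector `ξ = (γ, λ, X, χ)`. -/
abbrev Decision (n s p : ℕ) : Type :=
  ℝ × (Fin s → ℝ) × Matrix (Idx n) (Idx n) ℝ × (Fin p → ℝ)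

/-- The block matrix `F[ξ]` of the linear matrix inequality, at `ξ = (γ, λ, X, χ)`. -/
def F {n s p w : ℕ} (Q : Fin s → Matrix (Fin n) (Fin n) ℝ) (β : Fin w → ℝ)
    (M : (Fin p → ℝ) → Matrix (Fin w) (Idx n) ℝ) (ξ : Decision n s p) :
    Matrix (Idx n) (Idx n) ℝ :=
  match ξ with
  | (γ, lam, X, χ) =>
    Matrix.fromBlocks
      (Matrix.of fun _ _ => γ - psi β X (M χ) - ∑ i, lam i)
      (-phiT β X (M χ))
      (-phiT β X (M χ))ᵀ
      (∑ i, lam i • Q i - delta X)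

/-- The feasible set: all `ξ = (γ, λ, X, χ)` with `X` symmetric, `F[ξ] ⪰ 0`, `λ ≥ 0` and
`X ⪰ V[χ]`. -/
def feasibleSet {n s p w : ℕ} (Q : Fin s → Matrix (Fin n) (Fin n) ℝ) (β : Fin w → ℝ)
    (M : (Fin p → ℝ) → Matrix (Fin w) (Idx n) ℝ)
    (V : (Fin p → ℝ) → Matrix (Idx n) (Idx n) ℝ) : Set (Decision n s p) :=
  {ξ | match ξ with
    | (γ, lam, X, χ) =>
      X.IsSymm ∧ (F Q β M (γ, lam, X, χ)).PosSemidef ∧ (∀ i, 0 ≤ lam i) ∧ LoewnerGE X (V χ)}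

/-- `(γ, χ)` extends by some `λ` and `X` to a feasible `ξ`. -/
def Extendable {n s p w : ℕ} (Q : Fin s → Matrix (Fin n) (Fin n) ℝ) (β : Fin w → ℝ)
    (M : (Fin p → ℝ) → Matrix (Fin w) (Idx n) ℝ)
    (V : (Fin p → ℝ) → Matrix (Idx n) (Idx n) ℝ) (γ : ℝ) (χ : Fin p → ℝ) : Prop :=
  ∃ (lam : Fin s → ℝ) (X : Matrix (Idx n) (Idx n) ℝ), (γ, lam, X, χ) ∈ feasibleSet Q β M V

/-- `Θ = 2 ln(s+1) + 2 √(ln(s+1)) + 1`. -/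
noncomputable def Theta (s : ℕ) : ℝ :=
  2 * Real.log (s + 1) + 2 * Real.sqrt (Real.log (s + 1)) + 1

/-- The critical level `γ⁻` (used for `s ≥ 1`), where `Ψ` is the constant term of the
quadratic form. -/
noncomputable def gammaMinus (s : ℕ) (γ Ψ ε : ℝ) : ℝ :=
  if s = 1 then γ else 1 / Theta s * (γ - Ψ) + Ψ - ε

end RobustQuad

/-! Sufficiency is weak duality: testing `F` on `(1, ζ)` gives the bound with `X` in place of `V χ`,
because `⟨Q i ζ, ζ⟩ ≤ 1` and `λ ≥ 0`; then `X ⪰ V χ` finishes. Convexity holds because `F` is affine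
in `ξ` and `V` is matrix convex.

For the converse take `X = V χ`. Infeasibility puts a symmetric matrix outside the closed cone
`lmiCone`, and separation (`exists_dual_of_notMem_lmiCone`) yields a positive semidefinite `Y` that
has negative trace pairing with the objective and satisfies all constraints in trace form. It
remains to replace `Y` by a vector. Factor `Y = BᵀB` with `B H Bᵀ` diagonal
(`exists_sqrt_diagonalizing`). For every sign vector `σ`, the vector `z = σB` gives `zᵀHz = tr(HY)`
exactly, while any other form `zᵀSz` has mean `tr(SY)` over `σ`.

If `s = 1`, let `H` be the constraint: some `σ` makes the objective negative, with no loss. If `s >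
1`, let `H` be the objective. The `s` ellipsoids and the bound on the homogenizing coordinate make
`s + 1` constraints; exponential moments and a union bound (`exists_rounding`) keep all of them
below `Θ` at once. Dividing by `√Θ` and choosing the sign of `ζ` returns to an admissible point. -/

namespace RobustQuad

/-! ### Sign vectors and adapted square roots -/

/-- The real sign encoded by a Boolean. -/
def sgn (b : Bool) : ℝ := if b then 1 else -1

/-- The real vector of signs encoded by a Boolean vector. -/
def signVec {ι : Type*} (σ : ι → Bool) : ι → ℝ := fun i => sgn (σ i)

lemma sgn_mul_self (b : Bool) : sgn b * sgn b = 1 := by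
  cases b <;> simp [sgn]

/-- Flipping the `i`-th sign is a fixed-point-free involution that negates each summand. -/
lemma sum_signVec_mul_of_ne {ι : Type*} [Fintype ι] [DecidableEq ι] {i j : ι} (h : i ≠ j) :
    ∑ σ : ι → Bool, signVec σ i * signVec σ j = 0 := by
  refine Finset.sum_involution (fun σ _ => Function.update σ i (!σ i)) ?_ ?_ ?_ ?_
  · intro σ _
    have h1 : sgn (!σ i) = - sgn (σ i) := by cases σ i <;> simp [sgn]
    simp [signVec, Function.update_of_ne h.symm, h1]
  · intro σ _ _ h2
    have := congrFun h2 i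
    simp at this
  · simp
  · intro σ _
    simp

/-- The mean of a quadratic form over all sign vectors is its trace. -/
lemma sum_signVec_quad {ι : Type*} [Fintype ι] [DecidableEq ι] (A : Matrix ι ι ℝ) :
    ∑ σ : ι → Bool, signVec σ ⬝ᵥ (A *ᵥ signVec σ)
      = Fintype.card (ι → Bool) * A.trace := by
  have h1 : ∀ σ : ι → Bool, signVec σ ⬝ᵥ (A *ᵥ signVec σ)
      = ∑ i, ∑ j, A i j * (signVec σ i * signVec σ j) := by
    intro σ
    simp only [dotProduct, Matrix.mulVec, Finset.mul_sum]
    exact Finset.sum_congr rfl fun i _ => Finset.sum_congr rfl fun j _ => by ring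
  simp only [h1]
  rw [Finset.sum_comm, Matrix.trace, Finset.mul_sum]
  refine Finset.sum_congr rfl fun i _ => ?_
  rw [Finset.sum_comm, Finset.sum_eq_single i]
  · simp [signVec, sgn_mul_self, mul_comm]
  · intro j _ hj
    rw [← Finset.mul_sum, sum_signVec_mul_of_ne hj.symm, mul_zero]
  · simp

lemma signVec_quad_diagonal {ι : Type*} [Fintype ι] [DecidableEq ι] (d : ι → ℝ)
    (σ : ι → Bool) :
    signVec σ ⬝ᵥ (Matrix.diagonal d *ᵥ signVec σ) = (Matrix.diagonal d).trace := by
  simp only [dotProduct, Matrix.mulVec_diagonal, Matrix.trace_diagonal]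
  refine Finset.sum_congr rfl fun i _ => ?_
  rw [mul_left_comm]; simp [signVec, sgn_mul_self]

open scoped MatrixOrder Matrix.Norms.L2Operator in
lemma exists_eq_transpose_mul_self {ι : Type*} [Fintype ι] [DecidableEq ι] {Y : Matrix ι ι ℝ}
    (hY : Y.PosSemidef) : ∃ C : Matrix ι ι ℝ, Y = Cᵀ * C := by
  obtain ⟨C, hC⟩ := CStarAlgebra.nonneg_iff_eq_star_mul_self.mp hY.nonneg
  exact ⟨C, by rw [hC, Matrix.star_eq_conjTranspose,
    Matrix.conjTranspose_eq_transpose_of_trivial]⟩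

/-- A positive semidefinite matrix has a square root adapted to a given symmetric matrix. -/
lemma exists_sqrt_diagonalizing {ι : Type*} [Fintype ι] [DecidableEq ι] {Y H : Matrix ι ι ℝ}
    (hY : Y.PosSemidef) (hH : H.IsHermitian) :
    ∃ (B : Matrix ι ι ℝ) (d : ι → ℝ), Bᵀ * B = Y ∧ B * H * Bᵀ = Matrix.diagonal d := by
  obtain ⟨C, hC⟩ := exists_eq_transpose_mul_self hY
  have hK : (C * H * Cᵀ).IsHermitian := by
    have := Matrix.isHermitian_mul_mul_conjTranspose C hH
    rwa [Matrix.conjTranspose_eq_transpose_of_trivial] at this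
  let U : Matrix ι ι ℝ := hK.eigenvectorUnitary
  have hU1 : U * Uᵀ = 1 := by
    have := Unitary.mul_star_self_of_mem hK.eigenvectorUnitary.2
    rwa [Matrix.star_eq_conjTranspose, Matrix.conjTranspose_eq_transpose_of_trivial] at this
  have hU2 : Uᵀ * U = 1 := by
    have := Unitary.star_mul_self_of_mem hK.eigenvectorUnitary.2
    rwa [Matrix.star_eq_conjTranspose, Matrix.conjTranspose_eq_transpose_of_trivial] at this
  have hS : C * H * Cᵀ = U * Matrix.diagonal hK.eigenvalues * Uᵀ := by
    have := hK.spectral_theorem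
    rw [Unitary.conjStarAlgAut_apply, Matrix.star_eq_conjTranspose,
      Matrix.conjTranspose_eq_transpose_of_trivial] at this
    simpa [Function.comp_def] using this
  clear_value U
  generalize hK.eigenvalues = d at hS
  -- A square root is free up to a left orthogonal factor; the eigenvectors of `C H Cᵀ` supply the
  -- factor that diagonalizes.
  refine ⟨Uᵀ * C, d, ?_, ?_⟩
  · rw [Matrix.transpose_mul, Matrix.transpose_transpose, hC,
      show Cᵀ * U * (Uᵀ * C) = Cᵀ * (U * Uᵀ) * C by simp only [Matrix.mul_assoc], hU1,
      Matrix.mul_one]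
  · rw [Matrix.transpose_mul, Matrix.transpose_transpose,
      show Uᵀ * C * H * (Cᵀ * U) = Uᵀ * (C * H * Cᵀ) * U by simp only [Matrix.mul_assoc], hS,
      show Uᵀ * (U * Matrix.diagonal d * Uᵀ) * U
        = (Uᵀ * U) * Matrix.diagonal d * (Uᵀ * U) by simp only [Matrix.mul_assoc],
      hU2, Matrix.one_mul, Matrix.mul_one]

lemma vecMul_quad {ι κ : Type*} [Fintype ι] [Fintype κ] (x : κ → ℝ) (B : Matrix κ ι ℝ)
    (A : Matrix ι ι ℝ) :
    (x ᵥ* B) ⬝ᵥ (A *ᵥ (x ᵥ* B)) = x ⬝ᵥ ((B * A * Bᵀ) *ᵥ x) := by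
  rw [← Matrix.dotProduct_mulVec, ← Matrix.mulVec_transpose, Matrix.mulVec_mulVec,
    Matrix.mulVec_mulVec, Matrix.mul_assoc]

lemma trace_conj_eq {ι : Type*} [Fintype ι] {B Y : Matrix ι ι ℝ} (h : Bᵀ * B = Y)
    (A : Matrix ι ι ℝ) : (B * A * Bᵀ).trace = (A * Y).trace := by
  rw [← h, Matrix.mul_assoc, Matrix.trace_mul_comm, Matrix.mul_assoc]

/-- Rank-one extraction: a constraint on a positive semidefinite matrix can be kept by a vector
while a second quadratic form stays negative. -/
lemma exists_vec_of_trace {ι : Type*} [Fintype ι] [DecidableEq ι] {Y G A : Matrix ι ι ℝ}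
    (hY : Y.PosSemidef) (hG : G.IsHermitian) (hA : (A * Y).trace < 0) :
    ∃ z : ι → ℝ, z ⬝ᵥ (G *ᵥ z) = (G * Y).trace ∧ z ⬝ᵥ (A *ᵥ z) < 0 := by
  obtain ⟨B, d, hB, hd⟩ := exists_sqrt_diagonalizing hY hG
  have hsum := sum_signVec_quad (B * A * Bᵀ)
  rw [trace_conj_eq hB] at hsum
  have hneg : ∑ σ : ι → Bool, signVec σ ⬝ᵥ ((B * A * Bᵀ) *ᵥ signVec σ)
      < ∑ σ : ι → Bool, (0 : ℝ) := by
    rw [hsum, Finset.sum_const_zero]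
    exact mul_neg_of_pos_of_neg (by exact_mod_cast Fintype.card_pos) hA
  obtain ⟨σ, -, hσ⟩ := Finset.exists_lt_of_sum_lt hneg
  refine ⟨signVec σ ᵥ* B, ?_, ?_⟩
  · rw [vecMul_quad, hd, signVec_quad_diagonal, ← hd, trace_conj_eq hB]
  · rwa [vecMul_quad]

/-! ### Exponential moments of random signs -/

/-- Independence factors the sum into hyperbolic cosines, each bounded by `cosh x ≤ exp (x² / 2)`.
-/
lemma sum_signVec_exp_le {ι : Type*} [Fintype ι] [DecidableEq ι] (b : ι → ℝ) :
    ∑ σ : ι → Bool, Real.exp (b ⬝ᵥ signVec σ)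
      ≤ Fintype.card (ι → Bool) * Real.exp ((∑ i, b i ^ 2) / 2) := by
  have h1 : ∑ σ : ι → Bool, Real.exp (b ⬝ᵥ signVec σ)
      = ∏ i, ∑ s : Bool, Real.exp (b i * sgn s) := by
    rw [Finset.prod_univ_sum, Fintype.piFinset_univ]
    exact Finset.sum_congr rfl fun σ _ => by simp [dotProduct, Real.exp_sum, signVec]
  have h2 : ∀ i, ∑ s : Bool, Real.exp (b i * sgn s) ≤ 2 * Real.exp (b i ^ 2 / 2) := by
    intro i
    have := Real.cosh_le_exp_half_sq (b i)
    rw [Real.cosh_eq] at this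
    simp [sgn]
    linarith
  rw [h1]
  refine (Finset.prod_le_prod (fun i _ => by positivity) fun i _ => h2 i).trans (le_of_eq ?_)
  rw [Finset.prod_mul_distrib, ← Real.exp_sum, Finset.sum_div]
  simp

-- Gaussian linearization: for `t² = 2τ`, `exp (τ x²)` is the mean of `exp (t x g)` over a standard
-- normal `g`. The exponent is then linear in the signs, so the sub-Gaussian bound applies under the
-- integral, and a Gaussian integral remains, finite since `τ < 1/2`.
open MeasureTheory ProbabilityTheory in
lemma sum_exp_sq_signVec_le {ι : Type*} [Fintype ι] [DecidableEq ι] {b : ι → ℝ}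
    (hb : ∑ i, b i ^ 2 ≤ 1) {τ : ℝ} (h0 : 0 ≤ τ) (h1 : τ < 1 / 2) :
    ∑ σ : ι → Bool, Real.exp (τ * (b ⬝ᵥ signVec σ) ^ 2)
      ≤ Fintype.card (ι → Bool) * (√(1 - 2 * τ))⁻¹ := by
  set t := √(2 * τ) with ht
  have ht2 : t ^ 2 = 2 * τ := Real.sq_sqrt (by linarith)
  have hmgf : ∀ x : ℝ, Real.exp (τ * x ^ 2)
      = ∫ g, Real.exp (t * x * g) ∂(gaussianReal 0 1) := by
    intro x
    have h := mgf_gaussianReal (p := gaussianReal 0 1) (X := id) (μ := 0) (v := 1)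
      (by simp) (t * x)
    rw [mgf] at h
    simp only [id] at h
    rw [h]
    congr 1
    push_cast
    linear_combination (-(x ^ 2) / 2) * ht2
  simp only [hmgf]
  rw [← integral_finsetSum _ fun σ _ => integrable_exp_mul_gaussianReal _,
    integral_gaussianReal_eq_integral_smul one_ne_zero]
  set N : ℝ := ((Fintype.card (ι → Bool) : ℕ) : ℝ) with hN
  have hint : Integrable (fun g : ℝ => N * (√(2 * Real.pi))⁻¹ * Real.exp (-(1 / 2 - τ) * g ^ 2)) :=
    (integrable_exp_neg_mul_sq (by linarith)).const_mul _
  have hval : ∫ g : ℝ, N * (√(2 * Real.pi))⁻¹ * Real.exp (-(1 / 2 - τ) * g ^ 2)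
      = N * (√(1 - 2 * τ))⁻¹ := by
    rw [integral_const_mul, integral_gaussian, mul_assoc]
    congr 1
    rw [← Real.sqrt_inv, ← Real.sqrt_inv, ← Real.sqrt_mul (by positivity)]
    congr 1
    have : 1 - 2 * τ ≠ 0 := by linarith
    have : 1 / 2 - τ ≠ 0 := by linarith
    field_simp
  rw [← hval]
  refine integral_mono_of_nonneg (ae_of_all _ fun g => ?_) hint (ae_of_all _ fun g => ?_)
  · exact smul_nonneg (gaussianPDFReal_nonneg _ _ _) (Finset.sum_nonneg fun _ _ => by positivity)
  · have h3 := sum_signVec_exp_le (fun i => t * g * b i)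
    have h4 : ∀ σ : ι → Bool, (fun i => t * g * b i) ⬝ᵥ signVec σ
        = t * (b ⬝ᵥ signVec σ) * g := by
      intro σ
      rw [show (fun i => t * g * b i) = (t * g) • b from rfl, smul_dotProduct, smul_eq_mul]
      ring
    have h5 : (∑ i, (t * g * b i) ^ 2) / 2 ≤ τ * g ^ 2 := by
      simp only [mul_pow, ← Finset.mul_sum, ht2]
      nlinarith [mul_nonneg h0 (sq_nonneg g)]
    simp only [h4] at h3
    have h6 := h3.trans (mul_le_mul_of_nonneg_left (Real.exp_le_exp.2 h5)
      (by positivity : (0 : ℝ) ≤ N))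
    have h7 := mul_le_mul_of_nonneg_left h6 (gaussianPDFReal_nonneg 0 1 g)
    refine h7.trans (le_of_eq ?_)
    simp only [gaussianPDFReal, NNReal.coe_one, mul_one, sub_zero]
    rw [show -(1 / 2 - τ) * g ^ 2 = -g ^ 2 / 2 + τ * g ^ 2 by ring, Real.exp_add]
    ring

/-- Exponential moment of a trace-bounded positive semidefinite form at a random sign vector. -/
lemma sum_exp_quad_signVec_le {ι : Type*} [Fintype ι] [DecidableEq ι] {S : Matrix ι ι ℝ}
    (hS : S.PosSemidef) (hS1 : S.trace ≤ 1) {τ : ℝ} (h0 : 0 ≤ τ) (h1 : τ < 1 / 2) :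
    ∑ σ : ι → Bool, Real.exp (τ * (signVec σ ⬝ᵥ (S *ᵥ signVec σ)))
      ≤ Fintype.card (ι → Bool) * (√(1 - 2 * τ))⁻¹ := by
  obtain ⟨C, hC⟩ := exists_eq_transpose_mul_self hS
  set w : ι → ℝ := fun k => ∑ j, C k j ^ 2 with hw
  have hw0 : ∀ k, 0 ≤ w k := fun k => Finset.sum_nonneg fun _ _ => sq_nonneg _
  have hwsum : ∑ k, w k ≤ 1 := by
    refine le_trans (le_of_eq ?_) hS1
    rw [hC, Matrix.trace]
    simp only [Matrix.diag_apply, Matrix.mul_apply, Matrix.transpose_apply, hw]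
    rw [Finset.sum_comm]
    simp only [sq]
  have hquad : ∀ σ : ι → Bool, signVec σ ⬝ᵥ (S *ᵥ signVec σ) = ∑ k, (C.row k ⬝ᵥ signVec σ) ^ 2 := by
    intro σ
    rw [hC, ← Matrix.mulVec_mulVec, Matrix.dotProduct_mulVec, Matrix.vecMul_transpose]
    simp only [dotProduct, Matrix.mulVec, Matrix.row_apply, sq]
  -- Normalized rows of `C`; a zero row is sent to zero, since the inverse of `0` is `0`.
  set v : ι → ι → ℝ := fun k => (√(w k))⁻¹ • C.row k with hv
  have hv1 : ∀ k, ∑ j, v k j ^ 2 ≤ 1 := by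
    intro k
    simp only [hv, Pi.smul_apply, Matrix.row_apply, smul_eq_mul, mul_pow, ← Finset.mul_sum, inv_pow,
      Real.sq_sqrt (hw0 k)]
    exact inv_mul_le_one
  have hCv : ∀ k x, (C.row k ⬝ᵥ x) ^ 2 = w k * (v k ⬝ᵥ x) ^ 2 := by
    intro k x
    rcases (hw0 k).eq_or_lt with h | h
    · have : C.row k = 0 := by
        ext j
        have := (Finset.sum_eq_zero_iff_of_nonneg fun j _ => sq_nonneg (C k j)).1 h.symm j
          (Finset.mem_univ j)
        simpa using this
      simp [this, hv]
    · simp only [hv, smul_dotProduct, smul_eq_mul, mul_pow, inv_pow, Real.sq_sqrt h.le]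
      field_simp
  -- The weights `w k` sum to the trace, possibly less than 1; the missing mass is placed at the
  -- point `0`.
  have hjensen : ∀ σ : ι → Bool, Real.exp (τ * (signVec σ ⬝ᵥ (S *ᵥ signVec σ)))
      ≤ (1 - ∑ k, w k) + ∑ k, w k * Real.exp (τ * (v k ⬝ᵥ signVec σ) ^ 2) := by
    intro σ
    have := convexOn_exp.map_add_sum_le (t := Finset.univ) (w := w)
      (p := fun k => τ * (v k ⬝ᵥ signVec σ) ^ 2) (v := 1 - ∑ k, w k) (q := 0)
      (fun k _ => hw0 k) (by ring) (fun _ _ => Set.mem_univ _) (by linarith) (Set.mem_univ _)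
    simp only [smul_eq_mul, mul_zero, zero_add, Real.exp_zero, mul_one] at this
    refine le_trans (le_of_eq ?_) this
    rw [hquad, Finset.mul_sum]
    congr 1
    exact Finset.sum_congr rfl fun k _ => by rw [hCv]; ring
  set N : ℝ := ((Fintype.card (ι → Bool) : ℕ) : ℝ) with hN
  have hN0 : 0 ≤ N := by positivity
  have hr : 1 ≤ (√(1 - 2 * τ))⁻¹ := by
    refine (one_le_inv₀ (Real.sqrt_pos.2 (by linarith))).2 (Real.sqrt_le_one.2 (by linarith))
  clear_value v w
  refine (Finset.sum_le_sum fun σ _ => hjensen σ).trans ?_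
  rw [Finset.sum_add_distrib, Finset.sum_comm]
  simp only [← Finset.mul_sum]
  have h2 : ∑ k, w k * ∑ σ : ι → Bool, Real.exp (τ * (v k ⬝ᵥ signVec σ) ^ 2)
      ≤ ∑ k, w k * (N * (√(1 - 2 * τ))⁻¹) :=
    Finset.sum_le_sum fun k _ =>
      mul_le_mul_of_nonneg_left (sum_exp_sq_signVec_le (hv1 k) h0 h1) (hw0 k)
  rw [← Finset.sum_mul] at h2
  have h3 : ∑ _σ : ι → Bool, (1 - ∑ k, w k) = N * (1 - ∑ k, w k) := by
    simp [hN]; ring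
  rw [h3]
  nlinarith [mul_nonneg (mul_nonneg hN0 (sub_nonneg.2 hwsum)) (sub_nonneg.2 hr)]

/-! ### The factor `Θ` and semidefinite rounding -/

/-- The approximation factor for `N` ellipsoids. -/
noncomputable def ratio (N : ℝ) : ℝ := 2 * Real.log N + 2 * √(Real.log N) + 1

lemma exp_two_mul_gt {u : ℝ} (hu : 0 < u) : 1 + 2 * u + 2 * u ^ 2 < Real.exp (2 * u) := by
  have h := Real.sum_le_exp_of_nonneg (x := 2 * u) (by linarith) 4
  simp [Finset.sum_range_succ, Nat.factorial] at h
  have : 0 < u ^ 3 := by positivity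
  nlinarith

/-- With `u = √(log N)` the factor is `1 + 2u + 2u² < exp (2u)`, so its root is below `exp u`, and
the exponents `u² + u - (u + u²)` cancel. -/
lemma union_bound_ratio {N : ℝ} (hN : 1 < N) :
    N * (√(ratio N) * Real.exp (-((ratio N - 1) / 2))) < 1 := by
  have hL : 0 < Real.log N := Real.log_pos hN
  set u := √(Real.log N) with hu
  have hu0 : 0 < u := Real.sqrt_pos.2 hL
  have hu2 : Real.log N = u ^ 2 := (Real.sq_sqrt hL.le).symm
  have hr : ratio N = 1 + 2 * u + 2 * u ^ 2 := by
    rw [ratio, ← hu, hu2]; ring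
  have hN' : N = Real.exp (u ^ 2) := by rw [← hu2, Real.exp_log (by linarith)]
  have hs : √(ratio N) < Real.exp u := by
    rw [Real.sqrt_lt' (Real.exp_pos _), hr, ← Real.exp_nat_mul]
    exact_mod_cast exp_two_mul_gt hu0
  calc N * (√(ratio N) * Real.exp (-((ratio N - 1) / 2)))
      < N * (Real.exp u * Real.exp (-((ratio N - 1) / 2))) := by gcongr
    _ = 1 := by
      rw [hr]
      nth_rewrite 1 [hN']
      rw [← Real.exp_add, ← Real.exp_add, Real.exp_eq_one_iff]
      ring

lemma ratio_gt_one {N : ℝ} (hN : 1 < N) : 1 < ratio N := by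
  have hL : 0 < Real.log N := Real.log_pos hN
  have := Real.sqrt_nonneg (Real.log N)
  rw [ratio]; linarith

/-- Semidefinite rounding: a positive semidefinite matrix satisfying trace constraints is replaced
by a vector, at the price of a logarithmic factor in the constraints. -/
lemma exists_rounding {ι κ : Type*} [Fintype ι] [DecidableEq ι] [Fintype κ]
    (hκ : 1 < Fintype.card κ) {Y H : Matrix ι ι ℝ} (hY : Y.PosSemidef) (hH : H.IsHermitian)
    (S : κ → Matrix ι ι ℝ) (hS : ∀ k, (S k).PosSemidef) (hS1 : ∀ k, (S k * Y).trace ≤ 1) :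
    ∃ z : ι → ℝ, z ⬝ᵥ (H *ᵥ z) = (H * Y).trace ∧
      ∀ k, z ⬝ᵥ (S k *ᵥ z) ≤ ratio (Fintype.card κ) := by
  obtain ⟨B, d, hB, hd⟩ := exists_sqrt_diagonalizing hY hH
  set R := ratio (Fintype.card κ) with hR
  have hκ' : (1 : ℝ) < Fintype.card κ := by exact_mod_cast hκ
  have hR1 : 1 < R := ratio_gt_one hκ'
  -- This `τ` minimizes the Chernoff bound `exp (-τR) / √(1 - 2τ)`.
  set τ := (1 - 1 / R) / 2 with hτ
  have hR2 : 1 / R < 1 := by rw [div_lt_one (by linarith)]; exact hR1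
  have hR3 : 0 < 1 / R := by positivity
  have hτ0 : 0 < τ := by rw [hτ]; linarith
  have hτ1 : τ < 1 / 2 := by rw [hτ]; linarith
  have hτR : τ * R = (R - 1) / 2 := by rw [hτ]; field_simp
  have hinv : (√(1 - 2 * τ))⁻¹ = √R := by
    rw [← Real.sqrt_inv]; congr 1; rw [hτ]; field_simp; ring
  let q : κ → (ι → Bool) → ℝ := fun k σ => signVec σ ⬝ᵥ ((B * S k * Bᵀ) *ᵥ signVec σ)
  have hq : ∀ k, ∑ σ, Real.exp (τ * (q k σ - R))
      ≤ Fintype.card (ι → Bool) * (√R * Real.exp (-((R - 1) / 2))) := by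
    intro k
    have hpsd : (B * S k * Bᵀ).PosSemidef := by
      have := (hS k).mul_mul_conjTranspose_same B
      rwa [Matrix.conjTranspose_eq_transpose_of_trivial] at this
    have := sum_exp_quad_signVec_le hpsd (by rw [trace_conj_eq hB]; exact hS1 k) hτ0.le hτ1
    rw [hinv] at this
    have h2 : ∀ σ, Real.exp (τ * (q k σ - R))
        = Real.exp (τ * q k σ) * Real.exp (-((R - 1) / 2)) := by
      intro σ
      rw [← Real.exp_add, ← hτR]; ring_nf
    simp only [h2, ← Finset.sum_mul, ← mul_assoc]
    exact mul_le_mul_of_nonneg_right this (Real.exp_pos _).le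
  -- Union bound: the mean over `σ` of the summed exponentials is below 1, so a single `σ` keeps
  -- every one of them below 1.
  have hlt : ∑ σ : ι → Bool, ∑ k, Real.exp (τ * (q k σ - R)) < ∑ σ : ι → Bool, (1 : ℝ) := by
    rw [Finset.sum_comm]
    refine (Finset.sum_le_sum fun k _ => hq k).trans_lt ?_
    have h3 := union_bound_ratio hκ'
    have h4 : (0 : ℝ) < Fintype.card (ι → Bool) := by exact_mod_cast Fintype.card_pos
    have h5 := mul_lt_mul_of_pos_left h3 h4
    simp only [Finset.sum_const, nsmul_eq_mul, Finset.card_univ, mul_one] at h5 ⊢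
    refine lt_of_eq_of_lt ?_ h5
    ring
  obtain ⟨σ, -, hσ⟩ := Finset.exists_lt_of_sum_lt hlt
  refine ⟨signVec σ ᵥ* B, ?_, fun k => ?_⟩
  · rw [vecMul_quad, hd, signVec_quad_diagonal, ← hd, trace_conj_eq hB]
  · rw [vecMul_quad]
    have h6 : Real.exp (τ * (q k σ - R)) < 1 :=
      (Finset.single_le_sum (f := fun k => Real.exp (τ * (q k σ - R)))
        (fun _ _ => (Real.exp_pos _).le) (Finset.mem_univ k)).trans_lt hσ
    rw [Real.exp_lt_one_iff] at h6
    have : q k σ - R < 0 := by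
      by_contra! h
      exact absurd h6 (not_lt.2 (mul_nonneg hτ0.le h))
    exact (sub_neg.1 this).le

/-! ### Conic duality -/

lemma isClosed_posSemidef {ι : Type*} [Fintype ι] :
    IsClosed {A : Matrix ι ι ℝ | A.PosSemidef} := by
  have : {A : Matrix ι ι ℝ | A.PosSemidef}
      = {A | Aᵀ = A} ∩ ⋂ x : ι → ℝ, {A | 0 ≤ x ⬝ᵥ (A *ᵥ x)} := by
    ext A
    simp [Matrix.posSemidef_iff_dotProduct_mulVec, Matrix.IsHermitian,
      Matrix.conjTranspose_eq_transpose_of_trivial]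
  rw [this]
  refine (isClosed_eq (by fun_prop) continuous_id).inter (isClosed_iInter fun x => ?_)
  exact isClosed_le continuous_const (by fun_prop)

/-- The cone of matrices `A` such that `A + ∑ λ i • G i` is positive semidefinite for some
nonnegative `λ`. -/
def lmiCone {ι κ : Type*} [Fintype κ] (G : κ → Matrix ι ι ℝ) :
    Set (Matrix ι ι ℝ) :=
  {A | ∃ lam : κ → ℝ, (∀ k, 0 ≤ lam k) ∧ (A + ∑ k, lam k • G k).PosSemidef}

lemma add_mem_lmiCone {ι κ : Type*} [Fintype κ] {G : κ → Matrix ι ι ℝ} {A A' : Matrix ι ι ℝ}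
    (hA : A ∈ lmiCone G) (hA' : A' ∈ lmiCone G) : A + A' ∈ lmiCone G := by
  obtain ⟨l, hl, h⟩ := hA
  obtain ⟨l', hl', h'⟩ := hA'
  refine ⟨l + l', fun k => add_nonneg (hl k) (hl' k), ?_⟩
  convert h.add h' using 1
  simp only [Pi.add_apply, add_smul, Finset.sum_add_distrib]
  abel

lemma smul_mem_lmiCone {ι κ : Type*} [Fintype κ] {G : κ → Matrix ι ι ℝ} {A : Matrix ι ι ℝ}
    (hA : A ∈ lmiCone G) {c : ℝ} (hc : 0 ≤ c) : c • A ∈ lmiCone G := by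
  obtain ⟨l, hl, h⟩ := hA
  refine ⟨c • l, fun k => mul_nonneg hc (hl k), ?_⟩
  convert h.smul hc using 1
  simp only [Pi.smul_apply, smul_eq_mul, smul_add, Finset.smul_sum, mul_smul]

lemma mem_lmiCone_of_posSemidef {ι κ : Type*} [Fintype κ] (G : κ → Matrix ι ι ℝ)
    {A : Matrix ι ι ℝ} (hA : A.PosSemidef) : A ∈ lmiCone G :=
  ⟨0, fun _ => le_rfl, by simpa using hA⟩

lemma neg_mem_lmiCone {ι κ : Type*} [Fintype κ] [DecidableEq κ] (G : κ → Matrix ι ι ℝ) (k : κ) :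
    -G k ∈ lmiCone G := by
  refine ⟨Pi.single k 1, fun j => ?_, ?_⟩
  · by_cases h : j = k
    · subst h; simp
    · simp [h]
  · rw [Finset.sum_eq_single k (fun j _ hj => by simp [hj]) (by simp)]
    simpa using Matrix.PosSemidef.zero

lemma quad_sum_smul {ι κ : Type*} [Fintype ι] [Fintype κ] (l : κ → ℝ) (G : κ → Matrix ι ι ℝ)
    (v : ι → ℝ) :
    v ⬝ᵥ ((∑ k, l k • G k) *ᵥ v) = ∑ k, l k * (v ⬝ᵥ (G k *ᵥ v)) := by
  rw [Matrix.sum_mulVec, dotProduct_sum]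
  simp [Matrix.smul_mulVec, dotProduct_smul]

/-- Testing on `v` bounds the multipliers along a convergent sequence, so compactness gives a
limiting multiplier. -/
lemma isClosed_lmiCone {ι κ : Type*} [Fintype ι] [Fintype κ] {G : κ → Matrix ι ι ℝ}
    {v : ι → ℝ} (hv : ∀ k, v ⬝ᵥ (G k *ᵥ v) < 0) : IsClosed (lmiCone G) := by
  have : SequentialSpace (Matrix ι ι ℝ) := inferInstanceAs (SequentialSpace (ι → ι → ℝ))
  refine IsSeqClosed.isClosed fun A A₀ hA hlim => ?_
  choose l hl hpsd using hA
  have hcont : Continuous fun A : Matrix ι ι ℝ => v ⬝ᵥ (A *ᵥ v) := by fun_prop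
  obtain ⟨C, hC⟩ := ((hcont.tendsto A₀).comp hlim).bddAbove_range
  have hbound : ∀ m k, l m k ≤ C / -(v ⬝ᵥ (G k *ᵥ v)) := by
    intro m k
    rw [le_div_iff₀ (neg_pos.2 (hv k))]
    have h1 := (hpsd m).dotProduct_mulVec_nonneg v
    rw [star_trivial, Matrix.add_mulVec, dotProduct_add, quad_sum_smul] at h1
    have h2 : v ⬝ᵥ (A m *ᵥ v) ≤ C := hC ⟨m, rfl⟩
    have h3 := Finset.single_le_sum (f := fun k => l m k * -(v ⬝ᵥ (G k *ᵥ v)))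
      (fun j _ => mul_nonneg (hl m j) (neg_pos.2 (hv j)).le) (Finset.mem_univ k)
    simp only [mul_neg, Finset.sum_neg_distrib] at h3 ⊢
    linarith
  have hmem : ∀ m, l m ∈ Set.Icc (0 : κ → ℝ) fun k => C / -(v ⬝ᵥ (G k *ᵥ v)) :=
    fun m => ⟨fun k => hl m k, fun k => hbound m k⟩
  obtain ⟨l₀, hl₀, f, hf, hfl⟩ := isCompact_Icc.tendsto_subseq hmem
  refine ⟨l₀, fun k => hl₀.1 k, ?_⟩
  have hcont2 : Continuous fun x : Matrix ι ι ℝ × (κ → ℝ) => x.1 + ∑ k, x.2 k • G k := by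
    fun_prop
  have hlim2 := (hcont2.tendsto (A₀, l₀)).comp ((hlim.comp hf.tendsto_atTop).prodMk_nhds hfl)
  exact isClosed_posSemidef.mem_of_tendsto hlim2 (Filter.Eventually.of_forall fun m => hpsd (f m))

lemma linear_eq_trace {ι : Type*} [Fintype ι] [DecidableEq ι] (f : Matrix ι ι ℝ →ₗ[ℝ] ℝ) :
    ∃ Y : Matrix ι ι ℝ, Y.IsHermitian ∧ ∀ A : Matrix ι ι ℝ, A.IsHermitian → f A = (A * Y).trace := by
  let Z : Matrix ι ι ℝ := Matrix.of fun i j => f (Matrix.single j i 1)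
  have hZ : ∀ A : Matrix ι ι ℝ, f A = (A * Z).trace := by
    intro A
    conv_lhs => rw [Matrix.matrix_eq_sum_single A]
    simp only [map_sum, Matrix.trace, Matrix.diag_apply, Matrix.mul_apply]
    refine Finset.sum_congr rfl fun i _ => Finset.sum_congr rfl fun j _ => ?_
    rw [show Matrix.single i j (A i j) = A i j • Matrix.single i j (1 : ℝ) by simp, map_smul]
    rfl
  -- Symmetrizing the representing matrix does not change its pairing with symmetric matrices.
  refine ⟨(1 / 2 : ℝ) • (Z + Zᵀ), ?_, fun A hA => ?_⟩
  · rw [Matrix.IsHermitian, Matrix.conjTranspose_eq_transpose_of_trivial]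
    simp [add_comm]
  · rw [Matrix.IsHermitian, Matrix.conjTranspose_eq_transpose_of_trivial] at hA
    have : (A * Zᵀ).trace = (A * Z).trace := by
      rw [← Matrix.trace_transpose, Matrix.transpose_mul, Matrix.transpose_transpose, hA,
        Matrix.trace_mul_comm]
    rw [hZ, Matrix.mul_smul, Matrix.trace_smul, Matrix.mul_add, Matrix.trace_add, this, smul_eq_mul]
    ring

/-- Conic duality for a linear matrix inequality that satisfies a dual Slater condition. -/
lemma exists_dual_of_notMem_lmiCone {ι κ : Type*} [Fintype ι] [DecidableEq ι] [Fintype κ]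
    {G : κ → Matrix ι ι ℝ} (hG : ∀ k, (G k).IsHermitian) {v : ι → ℝ}
    (hv : ∀ k, v ⬝ᵥ (G k *ᵥ v) < 0) {A : Matrix ι ι ℝ} (hA : A.IsHermitian)
    (hA' : A ∉ lmiCone G) :
    ∃ Y : Matrix ι ι ℝ, Y.PosSemidef ∧ (A * Y).trace < 0 ∧ ∀ k, (G k * Y).trace ≤ 0 := by
  classical
  have : LocallyConvexSpace ℝ (Matrix ι ι ℝ) :=
    inferInstanceAs (LocallyConvexSpace ℝ (ι → ι → ℝ))
  let C : ProperCone ℝ (Matrix ι ι ℝ) :=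
    { carrier := lmiCone G
      add_mem' := add_mem_lmiCone
      zero_mem' := mem_lmiCone_of_posSemidef G Matrix.PosSemidef.zero
      smul_mem' := fun c _ hA => smul_mem_lmiCone hA c.2
      isClosed' := isClosed_lmiCone hv }
  obtain ⟨f, hf, hfA⟩ := C.hyperplane_separation_point (x₀ := A) hA'
  obtain ⟨Y, hY, hfY⟩ := linear_eq_trace (f : Matrix ι ι ℝ →ₗ[ℝ] ℝ)
  have hfY' : ∀ A : Matrix ι ι ℝ, A.IsHermitian → f A = (A * Y).trace := hfY
  refine ⟨Y, ?_, ?_, fun k => ?_⟩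
  · refine Matrix.PosSemidef.of_dotProduct_mulVec_nonneg hY fun x => ?_
    -- Pairing `Y` with `x xᵀ` gives `xᵀ Y x`.
    have hx : (Matrix.vecMulVec x x).PosSemidef := by
      simpa using Matrix.posSemidef_vecMulVec_self_star x
    have := hf _ (mem_lmiCone_of_posSemidef G hx)
    rw [hfY' _ hx.isHermitian, Matrix.vecMulVec_mul, Matrix.trace_vecMulVec,
      dotProduct_comm, ← Matrix.dotProduct_mulVec] at this
    simpa using this
  · rwa [← hfY' _ hA]
  · have := hf _ (neg_mem_lmiCone G k)
    rw [map_neg, hfY' _ (hG k)] at this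
    linarith

/-! ### Bordered block matrices and the data of the problem -/

/-- The symmetric block matrix with corner `a`, first row `b` and lower right block `D`. -/
def blk {n : ℕ} (a : ℝ) (b : Fin n → ℝ) (D : Matrix (Fin n) (Fin n) ℝ) :
    Matrix (Idx n) (Idx n) ℝ :=
  Matrix.fromBlocks (Matrix.of fun _ _ => a) (Matrix.of fun _ => b) (Matrix.of fun _ => b)ᵀ D

/-- The vector `(t, ζ)`. -/
def pairVec {n : ℕ} (t : ℝ) (ζ : Fin n → ℝ) : Idx n → ℝ := Sum.elim (fun _ => t) ζ

lemma exists_eq_pairVec {n : ℕ} (z : Idx n → ℝ) : ∃ t ζ, z = pairVec t ζ :=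
  ⟨z (Sum.inl ()), fun i => z (Sum.inr i), by ext (i | i) <;> rfl⟩

lemma blk_quad {n : ℕ} (a : ℝ) (b : Fin n → ℝ) (D : Matrix (Fin n) (Fin n) ℝ) (t : ℝ)
    (ζ : Fin n → ℝ) :
    pairVec t ζ ⬝ᵥ (blk a b D *ᵥ pairVec t ζ)
      = t ^ 2 * a + 2 * t * (b ⬝ᵥ ζ) + (D *ᵥ ζ) ⬝ᵥ ζ := by
  have h1 : (Matrix.of fun _ : Unit => b)ᵀ *ᵥ (fun _ : Unit => t) = t • b := by
    ext j; simp [Matrix.mulVec, dotProduct, mul_comm]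
  have h2 : (Matrix.of fun _ : Unit => b) *ᵥ ζ = fun _ => b ⬝ᵥ ζ := by
    ext j; simp [Matrix.mulVec]
  have h3 : (Matrix.of fun _ _ : Unit => a) *ᵥ (fun _ : Unit => t) = fun _ => a * t := by
    ext j; simp [Matrix.mulVec, dotProduct]
  rw [blk, pairVec, Matrix.fromBlocks_mulVec, Sum.elim_comp_inl, Sum.elim_comp_inr, h1, h2, h3,
    sumElim_dotProduct_sumElim, dotProduct_add, dotProduct_add, dotProduct_smul, dotProduct_comm ζ b,
    dotProduct_comm ζ (D *ᵥ ζ)]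
  simp [dotProduct]
  ring

lemma blk_add {n : ℕ} (a a' : ℝ) (b b' : Fin n → ℝ) (D D' : Matrix (Fin n) (Fin n) ℝ) :
    blk a b D + blk a' b' D' = blk (a + a') (b + b') (D + D') := by
  ext (i | i) (j | j) <;> simp [blk]

lemma blk_smul {n : ℕ} (c a : ℝ) (b : Fin n → ℝ) (D : Matrix (Fin n) (Fin n) ℝ) :
    c • blk a b D = blk (c * a) (c • b) (c • D) := by
  ext (i | i) (j | j) <;> simp [blk]

lemma blk_sum {n : ℕ} {κ : Type*} (s : Finset κ) (a : κ → ℝ) (D : κ → Matrix (Fin n) (Fin n) ℝ) :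
    ∑ k ∈ s, blk (a k) 0 (D k) = blk (∑ k ∈ s, a k) 0 (∑ k ∈ s, D k) := by
  ext (i | i) (j | j) <;> simp [blk, Matrix.sum_apply]

lemma blk_isHermitian {n : ℕ} {a : ℝ} {b : Fin n → ℝ} {D : Matrix (Fin n) (Fin n) ℝ}
    (hD : D.IsHermitian) : (blk a b D).IsHermitian :=
  Matrix.IsHermitian.fromBlocks (by ext i j; simp)
    (by rw [Matrix.conjTranspose_eq_transpose_of_trivial]) hD

lemma blk_posSemidef {n : ℕ} {a : ℝ} {D : Matrix (Fin n) (Fin n) ℝ} (ha : 0 ≤ a)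
    (hD : D.PosSemidef) : (blk a 0 D).PosSemidef := by
  refine Matrix.PosSemidef.of_dotProduct_mulVec_nonneg (blk_isHermitian hD.isHermitian) fun z => ?_
  obtain ⟨t, ζ, rfl⟩ := exists_eq_pairVec z
  have := hD.dotProduct_mulVec_nonneg ζ
  rw [star_trivial, dotProduct_comm] at this
  rw [star_trivial, blk_quad, zero_dotProduct, mul_zero, add_zero]
  positivity

lemma blk_posDef {n : ℕ} {a : ℝ} {D : Matrix (Fin n) (Fin n) ℝ} (ha : 0 < a)
    (hD : D.PosDef) : (blk a 0 D).PosDef := by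
  refine Matrix.PosDef.of_dotProduct_mulVec_pos (blk_isHermitian hD.isHermitian) fun z hz => ?_
  obtain ⟨t, ζ, rfl⟩ := exists_eq_pairVec z
  rw [star_trivial, blk_quad, zero_dotProduct, mul_zero, add_zero]
  by_cases hζ : ζ = 0
  · have ht : t ≠ 0 := by
      rintro rfl
      exact hz (by ext (i | i) <;> simp [pairVec, hζ])
    simp only [hζ, Matrix.mulVec_zero, dotProduct_zero, add_zero]
    positivity
  · have := hD.dotProduct_mulVec_pos hζ
    rw [star_trivial, dotProduct_comm] at this
    positivity

lemma delta_apply {n : ℕ} (X : Matrix (Idx n) (Idx n) ℝ) (i j : Fin n) :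
    delta X i j = X (Sum.inr i) (Sum.inr j) := by
  simp [delta, Pih, Matrix.mul_apply, Matrix.one_apply]

lemma phiT_apply {n w : ℕ} (β : Fin w → ℝ) (X : Matrix (Idx n) (Idx n) ℝ)
    (M : Matrix (Fin w) (Idx n) ℝ) (u : Unit) (j : Fin n) :
    phiT β X M u j = X (Sum.inl ()) (Sum.inr j) + (β ᵥ* M) (Sum.inr j) := by
  simp [phiT, Pih, Pic, Matrix.mul_apply, Matrix.one_apply, Matrix.vecMul, dotProduct]

lemma psi_eq {n w : ℕ} (β : Fin w → ℝ) (X : Matrix (Idx n) (Idx n) ℝ)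
    (M : Matrix (Fin w) (Idx n) ℝ) :
    psi β X M = X (Sum.inl ()) (Sum.inl ()) + 2 * (β ᵥ* M) (Sum.inl ()) := by
  simp [psi, Pic, Matrix.mul_apply, Matrix.vecMul, dotProduct]

lemma delta_isHermitian {n : ℕ} {X : Matrix (Idx n) (Idx n) ℝ} (hX : X.IsSymm) :
    (delta X).IsHermitian := by
  ext i j
  simp [delta_apply, hX.apply]

lemma F_eq_blk {n s p w : ℕ} (Q : Fin s → Matrix (Fin n) (Fin n) ℝ) (β : Fin w → ℝ)
    (M : (Fin p → ℝ) → Matrix (Fin w) (Idx n) ℝ) (γ : ℝ) (lam : Fin s → ℝ)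
    (X : Matrix (Idx n) (Idx n) ℝ) (χ : Fin p → ℝ) :
    F Q β M (γ, lam, X, χ) = blk (γ - psi β X (M χ) - ∑ i, lam i) (-(phiT β X (M χ)).row ())
      (∑ i, lam i • Q i - delta X) := rfl

lemma quadForm_eq {n w : ℕ} (β : Fin w → ℝ) (M : Matrix (Fin w) (Idx n) ℝ)
    {X : Matrix (Idx n) (Idx n) ℝ} (hX : X.IsSymm) (ζ : Fin n → ℝ) :
    quadForm β M X ζ
      = psi β X M + 2 * ((phiT β X M).row () ⬝ᵥ ζ) + (delta X *ᵥ ζ) ⬝ᵥ ζ := by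
  have h1 : X = blk (X (Sum.inl ()) (Sum.inl ())) (fun j => X (Sum.inl ()) (Sum.inr j))
      (delta X) := by
    ext (i | i) (j | j)
    · rfl
    · rfl
    · exact hX.apply _ _
    · simp [blk, delta_apply]
  have h2 := blk_quad (X (Sum.inl ()) (Sum.inl ())) (fun j => X (Sum.inl ()) (Sum.inr j))
    (delta X) 1 ζ
  rw [← h1] at h2
  have h3 : (phiT β X M).row () = (fun j => X (Sum.inl ()) (Sum.inr j))
      + fun j => (β ᵥ* M) (Sum.inr j) := by
    ext j; simp [phiT_apply]
  have h4 : β ⬝ᵥ (M *ᵥ extVec ζ)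
      = (β ᵥ* M) (Sum.inl ()) + (fun j => (β ᵥ* M) (Sum.inr j)) ⬝ᵥ ζ := by
    rw [Matrix.dotProduct_mulVec]
    simp [dotProduct, extVec, Fintype.sum_sum_type]
  rw [quadForm, h4, show extVec ζ = pairVec 1 ζ from rfl, h2, psi_eq, h3, add_dotProduct]
  ring

/-! ### Sufficiency and convexity -/

lemma quadForm_le_of_extendable {n s p w : ℕ} {Q : Fin s → Matrix (Fin n) (Fin n) ℝ}
    {β : Fin w → ℝ} {M : (Fin p → ℝ) → Matrix (Fin w) (Idx n) ℝ}
    {V : (Fin p → ℝ) → Matrix (Idx n) (Idx n) ℝ} {γ : ℝ} {χ : Fin p → ℝ}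
    (h : Extendable Q β M V γ χ) {ζ : Fin n → ℝ} (hζ : ζ ∈ uncertaintySet Q) :
    quadForm β (M χ) (V χ) ζ ≤ γ := by
  obtain ⟨lam, X, hX, hF, hlam, hXV⟩ := h
  have h1 : quadForm β (M χ) (V χ) ζ ≤ quadForm β (M χ) X ζ := by
    have := hXV.dotProduct_mulVec_nonneg (extVec ζ)
    rw [star_trivial, Matrix.sub_mulVec, dotProduct_sub] at this
    simp only [quadForm]
    linarith
  refine h1.trans ?_
  have h2 := hF.dotProduct_mulVec_nonneg (pairVec 1 ζ)
  rw [star_trivial, F_eq_blk, blk_quad, Matrix.sub_mulVec, sub_dotProduct,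
    dotProduct_comm (_ *ᵥ ζ) ζ,
    quad_sum_smul, neg_dotProduct] at h2
  have h3 : ∑ i, lam i * (ζ ⬝ᵥ (Q i *ᵥ ζ)) ≤ ∑ i, lam i :=
    Finset.sum_le_sum fun i _ => by
      have := hζ i
      rw [dotProduct_comm] at this
      exact mul_le_of_le_one_right (hlam i) this
  rw [quadForm_eq β (M χ) hX]
  linarith

lemma F_combo {n s p w : ℕ} (Q : Fin s → Matrix (Fin n) (Fin n) ℝ) (β : Fin w → ℝ)
    (M : (Fin p → ℝ) →ᵃ[ℝ] Matrix (Fin w) (Idx n) ℝ) {a b : ℝ} (hab : a + b = 1)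
    (ξ ξ' : Decision n s p) :
    F Q β M (a • ξ + b • ξ') = a • F Q β M ξ + b • F Q β M ξ' := by
  obtain ⟨γ, lam, X, χ⟩ := ξ
  obtain ⟨γ', lam', X', χ'⟩ := ξ'
  have hM : M (a • χ + b • χ') = a • M χ + b • M χ' := Convex.combo_affine_apply hab
  simp only [Prod.smul_mk, Prod.mk_add_mk, F_eq_blk, blk_smul, blk_add]
  have h1 : (∑ i, (a • lam + b • lam') i) = a * ∑ i, lam i + b * ∑ i, lam' i := by
    simp [Finset.sum_add_distrib, Finset.mul_sum]
  congr 1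
  · rw [h1]
    simp only [psi_eq, hM, Matrix.vecMul_add, Matrix.vecMul_smul, Matrix.add_apply,
      Matrix.smul_apply, Pi.add_apply, Pi.smul_apply, smul_eq_mul]
    ring
  · ext j
    simp only [phiT_apply, hM, Matrix.vecMul_add, Matrix.vecMul_smul, Matrix.add_apply,
      Matrix.smul_apply, Pi.add_apply, Pi.smul_apply, Pi.neg_apply, Matrix.row_apply, smul_eq_mul]
    ring
  · have h2 : ∑ i, (a • lam + b • lam') i • Q i
        = a • ∑ i, lam i • Q i + b • ∑ i, lam' i • Q i := by
      simp [add_smul, Finset.sum_add_distrib, Finset.smul_sum, mul_smul]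
    rw [h2]
    ext i j
    simp only [delta_apply, Matrix.add_apply, Matrix.smul_apply, Matrix.sub_apply, smul_eq_mul]
    ring

lemma convex_feasibleSet {n s p w : ℕ} (Q : Fin s → Matrix (Fin n) (Fin n) ℝ) (β : Fin w → ℝ)
    (M : (Fin p → ℝ) →ᵃ[ℝ] Matrix (Fin w) (Idx n) ℝ)
    {V : (Fin p → ℝ) → Matrix (Idx n) (Idx n) ℝ} (hV : MatrixConvex V) :
    Convex ℝ (feasibleSet Q β M V) := by
  rintro ⟨γ, lam, X, χ⟩ ⟨hX, hF, hlam, hXV⟩ ⟨γ', lam', X', χ'⟩ ⟨hX', hF', hlam', hXV'⟩ a b ha hb hab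
  refine ⟨?_, ?_, fun i => ?_, ?_⟩
  · exact (hX.smul a).add (hX'.smul b)
  · have := F_combo Q β M hab (γ, lam, X, χ) (γ', lam', X', χ')
    exact this ▸ (hF.smul ha).add (hF'.smul hb)
  · exact add_nonneg (mul_nonneg ha (hlam i)) (mul_nonneg hb (hlam' i))
  · have hb' : b = 1 - a := by linarith
    have h1 := hV a ha (by linarith) χ χ'
    rw [← hb'] at h1
    -- The averaged slacks `X - V` and the convexity defect of `V` add up to the slack at the
    -- averaged point.
    have h2 := ((hXV.smul ha).add (hXV'.smul hb)).add h1
    change (a • X + b • X' - V (a • χ + b • χ')).PosSemidef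
    convert h2 using 1
    simp only [smul_sub]
    abel

/-! ### Necessity up to the factor `Θ` -/

/-- Duality for the linear matrix inequality `F ⪰ 0` at `X = V χ`. -/
lemma exists_dual_of_not_extendable {n s p w : ℕ} {Q : Fin s → Matrix (Fin n) (Fin n) ℝ}
    (hQ : ∀ i, (Q i).PosSemidef)
    {β : Fin w → ℝ} {M : (Fin p → ℝ) → Matrix (Fin w) (Idx n) ℝ}
    {V : (Fin p → ℝ) → Matrix (Idx n) (Idx n) ℝ} {γ : ℝ} {χ : Fin p → ℝ}
    (hV : (V χ).IsSymm) (h : ¬ Extendable Q β M V γ χ) :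
    ∃ Y : Matrix (Idx n) (Idx n) ℝ, Y.PosSemidef ∧
      (blk (γ - psi β (V χ) (M χ)) (-(phiT β (V χ) (M χ)).row ()) (-delta (V χ)) * Y).trace < 0 ∧
      ∀ i, (blk (-1) 0 (Q i) * Y).trace ≤ 0 := by
  refine exists_dual_of_notMem_lmiCone (G := fun i => blk (-1) 0 (Q i))
    (fun i => blk_isHermitian (hQ i).isHermitian) (v := pairVec 1 0) (fun i => ?_)
    (blk_isHermitian (delta_isHermitian hV).neg) ?_
  · rw [blk_quad]; simp
  · rintro ⟨lam, hlam, hpsd⟩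
    refine h ⟨lam, V χ, hV, ?_, hlam, ?_⟩
    · simp only [blk_smul, smul_zero, blk_sum, blk_add, add_zero] at hpsd
      rw [F_eq_blk]
      convert hpsd using 2
      · simp [sub_eq_add_neg]
      · abel
    · rw [LoewnerGE, sub_self]; exact Matrix.PosSemidef.zero

lemma smul_quad {n : ℕ} (D : Matrix (Fin n) (Fin n) ℝ) (r : ℝ) (ζ : Fin n → ℝ) :
    (D *ᵥ (r • ζ)) ⬝ᵥ (r • ζ) = r ^ 2 * ((D *ᵥ ζ) ⬝ᵥ ζ) := by
  rw [Matrix.mulVec_smul, smul_dotProduct, dotProduct_smul, smul_eq_mul, smul_eq_mul]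
  ring

lemma trace_mul_nonneg {ι : Type*} [Fintype ι] [DecidableEq ι] {S Y : Matrix ι ι ℝ}
    (hS : S.PosSemidef) (hY : Y.PosSemidef) : 0 ≤ (S * Y).trace := by
  obtain ⟨B, hB⟩ := exists_eq_transpose_mul_self hY
  rw [← trace_conj_eq hB.symm]
  have := (hS.mul_mul_conjTranspose_same B).trace_nonneg
  rwa [Matrix.conjTranspose_eq_transpose_of_trivial] at this

/-- For `Y = BᵀB` the trace is that of the positive semidefinite `B P Bᵀ`, which must vanish; its
diagonal holds the `P`-energies of the rows of `B`. -/
lemma eq_zero_of_trace_mul_le_zero {ι : Type*} [Fintype ι] [DecidableEq ι] {P Y : Matrix ι ι ℝ}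
    (hP : P.PosDef) (hY : Y.PosSemidef) (h : (P * Y).trace ≤ 0) : Y = 0 := by
  obtain ⟨B, hB⟩ := exists_eq_transpose_mul_self hY
  rw [← trace_conj_eq hB.symm] at h
  have hpsd := hP.posSemidef.mul_mul_conjTranspose_same B
  rw [Matrix.conjTranspose_eq_transpose_of_trivial] at hpsd
  have h0 : B * P * Bᵀ = 0 := hpsd.trace_eq_zero_iff.1 (h.antisymm hpsd.trace_nonneg)
  have hB0 : B = 0 := by
    ext i j
    have h1 := vecMul_quad (Pi.single i 1) B P
    rw [h0, Matrix.zero_mulVec, dotProduct_zero] at h1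
    have h2 : Pi.single i 1 ᵥ* B = 0 := by
      by_contra hne
      have := hP.dotProduct_mulVec_pos hne
      rw [star_trivial, h1] at this
      exact lt_irrefl _ this
    simpa using congrFun h2 j
  rw [hB, hB0, Matrix.mul_zero]

/-- The exact S-lemma for a single ellipsoid, in dual form. -/
lemma exists_violation_single {n : ℕ} {Q : Matrix (Fin n) (Fin n) ℝ} (hQ : Q.PosDef)
    {c : ℝ} {φ : Fin n → ℝ} {D : Matrix (Fin n) (Fin n) ℝ} {Y : Matrix (Idx n) (Idx n) ℝ}
    (hY : Y.PosSemidef) (hA : (blk c (-φ) (-D) * Y).trace < 0)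
    (hG : (blk (-1) 0 Q * Y).trace ≤ 0) :
    ∃ ζ, (Q *ᵥ ζ) ⬝ᵥ ζ ≤ 1 ∧ c < 2 * (φ ⬝ᵥ ζ) + (D *ᵥ ζ) ⬝ᵥ ζ := by
  obtain ⟨z, hz1, hz2⟩ := exists_vec_of_trace hY (blk_isHermitian (a := -1) (b := 0)
    hQ.isHermitian) hA
  rw [← hz1] at hG
  obtain ⟨t, ζ, rfl⟩ := exists_eq_pairVec z
  rw [blk_quad, zero_dotProduct, mul_zero, add_zero] at hG
  rw [blk_quad, neg_dotProduct, Matrix.neg_mulVec, neg_dotProduct] at hz2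
  -- At `t = 0` the constraint and definiteness of `Q` force `ζ = 0`, against the strict negativity.
  have ht : t ≠ 0 := by
    rintro rfl
    have hζ : ζ = 0 := by
      by_contra hne
      have := hQ.dotProduct_mulVec_pos hne
      rw [star_trivial, dotProduct_comm] at this
      linarith
    simp [hζ] at hz2
  have ht2 : 0 < t ^ 2 := by positivity
  refine ⟨t⁻¹ • ζ, ?_, ?_⟩
  · rw [smul_quad, inv_pow, inv_mul_le_iff₀ ht2]
    linarith
  · rw [smul_quad, dotProduct_smul, smul_eq_mul, inv_pow]
    have h1 : c * t ^ 2 < 2 * t * (φ ⬝ᵥ ζ) + (D *ᵥ ζ) ⬝ᵥ ζ := by linarith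
    rw [← lt_div_iff₀ ht2] at h1
    refine h1.trans_le (le_of_eq ?_)
    field_simp

lemma ratio_card_option (s : ℕ) : ratio (Fintype.card (Option (Fin s))) = Theta s := by
  simp [ratio, Theta]

/-- The approximate S-lemma for several ellipsoids, in dual form. -/
lemma exists_violation_of_dual {n s : ℕ} (hs : 1 ≤ s) {Q : Fin s → Matrix (Fin n) (Fin n) ℝ}
    (hQ : ∀ i, (Q i).PosSemidef) (hQsum : (∑ i, Q i).PosDef)
    {c : ℝ} {φ : Fin n → ℝ} {D : Matrix (Fin n) (Fin n) ℝ} (hD : D.IsHermitian)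
    {Y : Matrix (Idx n) (Idx n) ℝ} (hY : Y.PosSemidef)
    (hA : (blk c (-φ) (-D) * Y).trace < 0) (hG : ∀ i, (blk (-1) 0 (Q i) * Y).trace ≤ 0) :
    ∃ ζ ∈ uncertaintySet Q, 1 / Theta s * c < 2 * (φ ⬝ᵥ ζ) + (D *ᵥ ζ) ⬝ᵥ ζ := by
  have hE : (blk (n := n) 1 0 0).PosSemidef := blk_posSemidef zero_le_one Matrix.PosSemidef.zero
  have hS : ∀ i, (blk 0 0 (Q i)).PosSemidef := fun i => blk_posSemidef le_rfl (hQ i)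
  set T := (blk (n := n) 1 0 0 * Y).trace with hT
  have hGS : ∀ i, (blk 0 0 (Q i) * Y).trace ≤ T := by
    intro i
    have h1 : blk 0 0 (Q i) = blk (-1) 0 (Q i) + blk 1 0 0 := by rw [blk_add]; simp
    rw [h1, Matrix.add_mul, Matrix.trace_add]
    linarith [hG i]
  -- If the corner mass `T` vanished, `Y` would pair to at most zero with a positive definite matrix
  -- and so be zero.
  have hTpos : 0 < T := by
    refine lt_of_le_of_ne (trace_mul_nonneg hE hY) fun h0 => ?_
    have h1 : blk 1 0 (∑ i, Q i) = blk 1 0 0 + ∑ i, blk 0 0 (Q i) := by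
      rw [blk_sum, blk_add]; simp
    have h2 : (blk 1 0 (∑ i, Q i) * Y).trace ≤ 0 := by
      rw [h1, Matrix.add_mul, Matrix.trace_add, Matrix.sum_mul, Matrix.trace_sum, ← hT, ← h0,
        zero_add]
      exact Finset.sum_nonpos fun i _ => h0 ▸ hGS i
    have := eq_zero_of_trace_mul_le_zero (blk_posDef one_pos hQsum) hY h2
    simp [this] at hA
  -- `Y` is scaled to corner mass 1. The extra index `none` carries the constraint on `t²`, hence `s
  -- + 1` inside the logarithm.
  obtain ⟨z, hz1, hz2⟩ := exists_rounding (κ := Option (Fin s)) (by simp; omega)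
    (hY.smul (inv_nonneg.2 hTpos.le)) (H := blk 0 φ D) (blk_isHermitian hD)
    (fun k => k.elim (blk 1 0 0) fun i => blk 0 0 (Q i))
    (fun k => by cases k <;> simp [hE, hS])
    (fun k => by
      rw [Matrix.mul_smul, Matrix.trace_smul, smul_eq_mul, inv_mul_le_iff₀ hTpos, mul_one]
      cases k with
      | none => exact le_rfl
      | some i => exact hGS i)
  have hΘ : 0 < Theta s := by
    rw [← ratio_card_option]
    exact one_pos.trans (ratio_gt_one (by simp; omega))
  have hH : c < z ⬝ᵥ (blk 0 φ D *ᵥ z) := by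
    have h1 : blk 0 φ D = c • blk 1 0 0 + (-1 : ℝ) • blk c (-φ) (-D) := by
      rw [blk_smul, blk_smul, blk_add]; simp
    rw [hz1, Matrix.mul_smul, Matrix.trace_smul, smul_eq_mul, lt_inv_mul_iff₀ hTpos, h1,
      Matrix.add_mul, Matrix.trace_add, Matrix.smul_mul, Matrix.smul_mul, Matrix.trace_smul,
      Matrix.trace_smul, ← hT, smul_eq_mul, smul_eq_mul]
    linarith
  rw [ratio_card_option] at hz2
  obtain ⟨t, ζ, rfl⟩ := exists_eq_pairVec z
  have ht : t ^ 2 ≤ Theta s := by simpa [blk_quad] using hz2 none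
  have hQζ : ∀ i, (Q i *ᵥ ζ) ⬝ᵥ ζ ≤ Theta s := fun i => by simpa [blk_quad] using hz2 (some i)
  rw [blk_quad, mul_zero, zero_add] at hH
  -- The ellipsoids are symmetric, so `ζ` may be reflected to make the linear term nonnegative;
  -- enlarging `t` to `√Θ` then only increases the objective.
  obtain ⟨e, he, heφ⟩ : ∃ e : ℝ, e ^ 2 = 1 ∧ e * (φ ⬝ᵥ ζ) = |φ ⬝ᵥ ζ| := by
    rcases abs_cases (φ ⬝ᵥ ζ) with h | h
    · exact ⟨1, by norm_num, by rw [h.1, one_mul]⟩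
    · exact ⟨-1, by norm_num, by rw [h.1]; ring⟩
  set r := √(Theta s) with hr
  have hr0 : 0 < r := Real.sqrt_pos.2 hΘ
  have hr2 : r ^ 2 = Theta s := Real.sq_sqrt hΘ.le
  have htr : |t| ≤ r := Real.abs_le_sqrt ht
  have hsq : (e * r⁻¹) ^ 2 = (Theta s)⁻¹ := by rw [mul_pow, he, one_mul, inv_pow, hr2]
  refine ⟨(e * r⁻¹) • ζ, fun i => ?_, ?_⟩
  · rw [smul_quad, hsq, inv_mul_le_iff₀ hΘ, mul_one]
    exact hQζ i
  · rw [smul_quad, hsq, dotProduct_smul, smul_eq_mul, one_div, inv_mul_lt_iff₀ hΘ, mul_add,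
      mul_inv_cancel_left₀ hΘ.ne']
    have h1 : Theta s * (2 * (e * r⁻¹ * (φ ⬝ᵥ ζ))) = 2 * (r * |φ ⬝ᵥ ζ|) := by
      rw [← heφ, ← hr2]; field_simp
    have h2 : t * (φ ⬝ᵥ ζ) ≤ r * |φ ⬝ᵥ ζ| :=
      (le_abs_self _).trans (abs_mul t _ ▸ mul_le_mul_of_nonneg_right htr (abs_nonneg _))
    rw [h1]
    linarith

end RobustQuad

theorem theorem1 {n s p w : ℕ} (hs : 1 ≤ s)
    (Q : Fin s → Matrix (Fin n) (Fin n) ℝ)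
    (hQ : ∀ i, (Q i).PosSemidef) (hQsum : (∑ i, Q i).PosDef)
    (β : Fin w → ℝ)
    (M : (Fin p → ℝ) →ᵃ[ℝ] Matrix (Fin w) (RobustQuad.Idx n) ℝ)
    (V : (Fin p → ℝ) → Matrix (RobustQuad.Idx n) (RobustQuad.Idx n) ℝ)
    (hVsymm : ∀ χ, (V χ).IsSymm) (hVconv : RobustQuad.MatrixConvex V) :
    -- feasibility of the LMI is sufficient for the robust quadratic inequality
    (∀ (γ : ℝ) (χ : Fin p → ℝ), RobustQuad.Extendable Q β M V γ χ →
      ∀ ζ ∈ RobustQuad.uncertaintySet Q, RobustQuad.quadForm β (M χ) (V χ) ζ ≤ γ) ∧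
    -- the feasible set is convex
    Convex ℝ (RobustQuad.feasibleSet Q β M V) ∧
    -- if there is no extension, the inequality is violated at the critical level
    (∀ (γ : ℝ) (χ : Fin p → ℝ), ¬ RobustQuad.Extendable Q β M V γ χ →
      ∀ ε : ℝ, 0 < ε → ∃ ζ ∈ RobustQuad.uncertaintySet Q,
        RobustQuad.gammaMinus s γ (RobustQuad.psi β (V χ) (M χ)) ε <
          RobustQuad.quadForm β (M χ) (V χ) ζ) := by
  refine ⟨fun γ χ h ζ hζ => RobustQuad.quadForm_le_of_extendable h hζ,
    RobustQuad.convex_feasibleSet Q β M hVconv, fun γ χ h ε hε => ?_⟩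
  obtain ⟨Y, hY, hA, hG⟩ := RobustQuad.exists_dual_of_not_extendable hQ (hVsymm χ) h
  by_cases hs1 : s = 1
  · subst hs1
    rw [Fin.sum_univ_one] at hQsum
    obtain ⟨ζ, hζ, hlt⟩ := RobustQuad.exists_violation_single hQsum hY hA (hG 0)
    refine ⟨ζ, fun i => by rwa [Subsingleton.elim i 0], ?_⟩
    rw [RobustQuad.gammaMinus, if_pos rfl, RobustQuad.quadForm_eq β (M χ) (hVsymm χ)]
    linarith
  · obtain ⟨ζ, hζ, hlt⟩ := RobustQuad.exists_violation_of_dual hs hQ hQsum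
      (RobustQuad.delta_isHermitian (hVsymm χ)) hY hA hG
    refine ⟨ζ, hζ, ?_⟩
    rw [RobustQuad.gammaMinus, if_neg hs1, RobustQuad.quadForm_eq β (M χ) (hVsymm χ)]
    -- The strict bound already holds at `ε = 0`.
    linarith
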